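/- **Model.** A $K$-armed bandit instance $\nu=(P_1,\dots,P_K)$ has reward laws $P_i$ on $[0,1]$ with means $\mu_i$; $\mu^\star=\max_i\mu_i$. For $B\ge 1$, a horizon $T\ge1$, and $W>0$, an *adaptive-grid $B$-batch bandit algorithm with persistent state space $\mathcal M$* (a finite set) consists of a random seed $U$ (with a law chosen by the algorithm, independent of the rewards), an initial state $M_0\in\mathcal M$, and measurable maps $\psi_b,\rho_{b,t},\phi_t$, with which it plays as follows. Put $t_0=0$, $t_B=T$ and $t_b=\psi_b(t_{b-1},M_{t_{b-1}},U)$ for $1\le b<B$, where it is required that $t_{b-1}<t_b<T$. For $1\le b\le B$ and each round $t\in\{t_{b-1}+1,\dots,t_b\}$, the arm pulled is $A_t=\rho_{b,t}(t_{b-1},M_{t_{b-1}},U)\in\{1,\dots,K\}$, a reward $R_t\sim P_{A_t}$ is observed (rewards are independent across pulls), and the state becomes $M_t=\phi_t(M_{t-1},U,A_t,R_t)\in\mathcal M$. The pseudo-regret is $\mathrm{Reg}_T=\sum_{t=1}^T(\mu^\star-\mu_{A_t})$, and $\mathbb E_\nu$ is the expectation over the seed and the rewards under $\nu$. Let $\mathcal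 V_{\mathrm{Ber}}$ be the set of all instances $(\mathrm{Ber}(\mu_1),\dots,\mathrm{Ber}(\mu_K))$ with $\mu_1,\dots,\mu_K\in[0,1]$. Here $\log$ is the natural logarithm. **Theorem.** There are universal constants $c,\gamma_0>0$ such that the following holds for every even $K\ge2$, all integers $T,B\ge1$, every real $W>0$ and every $C\ge1$. Let $\mathcal A$ be an adaptive-grid $B$-batch bandit algorithm for $K$ arms and horizon $T$ with persistent state space $\mathcal M$, $|\mathcal M|\le 2^W$. If $$\sup_{\nu\in\mathcal V_{\mathrm{Ber}}}\mathbb E_\nu[\mathrm{Reg}_T]\le C\sqrt{KT}\,\log T\,\log K \qquad\text{and}\qquad T\ge c\,C^6K\log^6T\,\log^6K,$$ then $$B\ \ge\ \frac{\gamma_0K-\frac12\log_2(2K)}{W}.$$ In particular $B=\Omega(K/W)$: there are universal constants $\gamma>0$ and $K_0$ such that, under the same hypotheses, $B\ge\gamma K/W$ whenever $K\ge K_0$. -/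

import Mathlib

open MeasureTheory ProbabilityTheory

/-- A `K`-armed stochastic bandit instance: arm `i` has a reward law `ν i` on `[0,1]`. -/
abbrev BanditInstance (K : ℕ) : Type := Fin K → ProbabilityMeasure unitInterval

namespace BanditInstance

variable {K : ℕ}

/-- The mean reward of arm `i`. -/
noncomputable def mean (ν : BanditInstance K) (i : Fin K) : ℝ :=
  ∫ x : unitInterval, (x : ℝ) ∂(ν i : Measure unitInterval)

/-- The largest mean reward. -/
noncomputable def bestMean (ν : BanditInstance K) : ℝ := ⨆ i, ν.mean i

/-- The class of Bernoulli instances: every arm `i` has the law on `{0,1}` with mean `p i`,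
where `p i ∈ [0,1]` is arbitrary. -/
def bernoulliClass (K : ℕ) : Set (BanditInstance K) :=
  {ν | ∃ p : Fin K → unitInterval, ∀ i,
    (ν i : Measure unitInterval) = bernoulliMeasure (1 : unitInterval) 0 (p i)}

end BanditInstance

/-- The data of an adaptive-grid bandit algorithm with `K` arms, horizon `T`, `B` batches,
persistent states in `M` and a random seed in `Seed`.  Rounds are numbered `1, …, T` and batches
`1, …, B`.

* `boundary b (t_{b-1}, M_{t_{b-1}}, U)` is the end `t_b` of batch `b`, for `1 ≤ b < B`;
* `plan b t (t_{b-1}, M_{t_{b-1}}, U)` is the arm pulled in round `t` of batch `b`;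
* `update t (M_{t-1}, U, A_t, R_t)` is the persistent state `M_t`.

The requirement `t_{b-1} < t_b < T`, which makes the number of batches exactly `B`, is
`BatchedBandit.IsGridValid` below. -/
structure BatchedBandit (K T B : ℕ) (M Seed : Type*) [MeasurableSpace M] [MeasurableSpace Seed] where
  seedLaw : Measure Seed
  isProbabilityMeasure_seedLaw : IsProbabilityMeasure seedLaw
  init : M
  boundary : ℕ → ℕ × M × Seed → ℕ
  plan : ℕ → ℕ → ℕ × M × Seed → Fin K
  update : ℕ → M × Seed × Fin K × unitInterval → M
  measurable_boundary : ∀ b, Measurable (boundary b)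
  measurable_plan : ∀ b t, Measurable (plan b t)
  measurable_update : ∀ t, Measurable (update t)

/-- The situation just before a round is played: the number `batch` of the running batch `b`, its
endpoints `start = t_{b-1}` and `finish = t_b`, the state `anchor = M_{t_{b-1}}` at its beginning, the
current persistent state `mem`, and the number `pulls i` of earlier pulls of each arm `i`.
(Only `mem` is memory of the learner; the rest is bookkeeping of the interaction.) -/
structure RoundState (K : ℕ) (M : Type*) where
  batch : ℕ
  start : ℕ
  finish : ℕ
  anchor : M
  mem : M
  pulls : Fin K → ℕ

namespace BatchedBandit

variable {K T B : ℕ} {M Seed : Type*} [MeasurableSpace M] [MeasurableSpace Seed]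

/-- Batch `b` begins at time `s` with persistent state `m`.  Its end is chosen by `boundary` if `b`
is not the last batch, and is `T` if it is. -/
def beginBatch (alg : BatchedBandit K T B M Seed) (u : Seed) (b s : ℕ) (m : M) (N : Fin K → ℕ) :
    RoundState K M where
  batch := b
  start := s
  finish := if b < B then alg.boundary b (s, m, u) else T
  anchor := m
  mem := m
  pulls := N

/-- The arm pulled in round `t` when the situation before that round is `s`.  It depends only on
the batch, the round, and `(t_{b-1}, M_{t_{b-1}}, U)`. -/
def armAt (alg : BatchedBandit K T B M Seed) (u : Seed) (t : ℕ) (s : RoundState K M) : Fin K :=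
  alg.plan s.batch t (s.start, s.anchor, u)

/-- The situation after `t` rounds, just before round `t + 1`, for seed `u` and reward table `X`:
`X (i, n)` is the reward of the pull number `n + 1` of arm `i`.  When round `t + 1` is the last one
of its batch, the next batch begins. -/
def stateAfter (alg : BatchedBandit K T B M Seed) (u : Seed) (X : Fin K × ℕ → unitInterval) :
    ℕ → RoundState K M
  | 0 => alg.beginBatch u 1 0 alg.init (fun _ => 0)
  | t + 1 =>
    let s := alg.stateAfter u X t
    let a := alg.armAt u (t + 1) s
    let m := alg.update (t + 1) (s.mem, u, a, X (a, s.pulls a))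
    let N := Function.update s.pulls a (s.pulls a + 1)
    if t + 1 = s.finish then alg.beginBatch u (s.batch + 1) (t + 1) m N
    else { s with mem := m, pulls := N }

/-- The arm `A_{t+1}` pulled in round `t + 1`. -/
def action (alg : BatchedBandit K T B M Seed) (u : Seed) (X : Fin K × ℕ → unitInterval)
    (t : ℕ) : Fin K :=
  alg.armAt u (t + 1) (alg.stateAfter u X t)

/-- Every realized internal boundary `t_b`, `1 ≤ b < B`, satisfies `t_{b-1} < t_b < T`. -/
def IsGridValid (alg : BatchedBandit K T B M Seed) : Prop :=
  ∀ (u : Seed) (X : Fin K × ℕ → unitInterval), ∀ t < T,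
    (alg.stateAfter u X t).batch < B →
      (alg.stateAfter u X t).start < (alg.stateAfter u X t).finish ∧
      (alg.stateAfter u X t).finish < T

/-- The pseudo-regret `∑_{t=1}^T (μ⋆ - μ_{A_t})`. -/
noncomputable def pseudoRegret (alg : BatchedBandit K T B M Seed) (ν : BanditInstance K)
    (ω : Seed × (Fin K × ℕ → unitInterval)) : ℝ :=
  ∑ t ∈ Finset.range T, (ν.bestMean - ν.mean (alg.action ω.1 ω.2 t))

/-- The law of seed and reward table under the instance `ν`: the seed is independent of the table,
whose entries are independent, the entries of arm `i` having law `ν i`. -/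
noncomputable def lawUnder (alg : BatchedBandit K T B M Seed) (ν : BanditInstance K) :
    Measure (Seed × (Fin K × ℕ → unitInterval)) :=
  alg.seedLaw.prod (Measure.infinitePi fun p : Fin K × ℕ => (ν p.1 : Measure unitInterval))

/-- The expected pseudo-regret under the instance `ν`. -/
noncomputable def expectedRegret (alg : BatchedBandit K T B M Seed) (ν : BanditInstance K) : ℝ :=
  ∫ ω, alg.pseudoRegret ν ω ∂(alg.lawUnder ν)

end BatchedBandit

/-! Few pulls statistics are reachable, yet small regret forces many. For a fixed seed the arms of a
batch depend only on the persistent state at its start, so the final pull counts are a function of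
the `B` states at the batch starts and take at most `|M| ^ B ≤ 2 ^ (W * B)` values
(`exists_finset_pulls_mem`).

Conversely, for nonempty `S` give the arms in `S` mean `1/2` and the others `1/4`, and call an arm
heavy if it is pulled at least `m` times, with `m` of order `1 / ε ^ 2`. A heavy arm outside `S`
costs at least `m / 4`, so few occur. If an arm of `S` is raised to `1/2 + ε`, it becomes the best
one by a gap `ε`, and low regret makes it heavy with high probability. Whether it is heavy is
decided by its first `m` rewards and the other arms, and `m` rewards hardly distinguish `1/2` from
`1/2 + ε`; so it is heavy with high probability under `S` too (`lawUnder_notMem_heavyArms_le`). Thus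
the heavy set differs from `S` in at most `K / 32` arms on average
(`integral_card_symmDiff_heavyArms_le`).

The seed law does not depend on the instance, so one seed serves all `S` on average. The heavy sets
for that seed form a code of size at most `2 ^ (W * B)` approximating the nonempty subsets, and a
Hamming volume count (`Finset.card_mul_exp_le_of_sum_card_symmDiff_le`) makes `W * B` linear in `K`.
-/

/-! ### Change of measure in infinite products. -/

namespace MeasureTheory.Measure

open scoped ENNReal

variable {ι : Type*}

/-- A product measure, finitely many of whose factors have a density, has the product density. -/
theorem infinitePi_eq_withDensity {Ω : ι → Type*} [∀ i, MeasurableSpace (Ω i)]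
    (μ ν : ∀ i, Measure (Ω i)) [∀ i, IsProbabilityMeasure (μ i)] [∀ i, IsProbabilityMeasure (ν i)]
    (F : Finset ι) (f : ∀ i, Ω i → ℝ≥0∞) (hf : ∀ i, Measurable (f i))
    (hF : ∀ i ∈ F, ν i = (μ i).withDensity (f i)) (hFc : ∀ i ∉ F, ν i = μ i) :
    infinitePi ν = (infinitePi μ).withDensity (fun x => ∏ i ∈ F, f i (x i)) := by
  classical
  symm
  refine eq_infinitePi _ fun s t ht => ?_
  have hbox : MeasurableSet ((s : Set ι).pi t) := .pi s.countable_toSet fun i _ => ht i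
  rw [withDensity_apply _ hbox, ← lintegral_indicator hbox]
  -- On a box, indicator and density both factor over coordinates; `φ i` is the share of coordinate
  -- `i`, so independence applies on the finite set `s ∪ F`.
  let φ : ∀ i, Ω i → ℝ≥0∞ := fun i y =>
    (if i ∈ s then (t i).indicator 1 y else 1) * (if i ∈ F then f i y else 1)
  have hφ : ∀ i, Measurable (φ i) := by
    intro i
    refine Measurable.mul ?_ ?_
    · split_ifs
      · exact measurable_one.indicator (ht i)
      · exact measurable_const
    · split_ifs
      · exact hf i
      · exact measurable_const
  have hprod : ∀ x : ∀ i, Ω i,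
      ((s : Set ι).pi t).indicator (fun x => ∏ i ∈ F, f i (x i)) x =
        ∏ i ∈ s ∪ F, φ i (x i) := by
    intro x
    rw [Finset.prod_mul_distrib, Finset.prod_ite_mem, Finset.prod_ite_mem,
      Finset.union_inter_cancel_left, Finset.union_inter_cancel_right]
    by_cases hx : x ∈ (s : Set ι).pi t
    · have h1 : ∏ i ∈ s, (t i).indicator (1 : Ω i → ℝ≥0∞) (x i) = 1 :=
        Finset.prod_eq_one fun i hi => Set.indicator_of_mem (hx i hi) _
      rw [Set.indicator_of_mem hx, h1, one_mul]
    · rw [Set.indicator_of_notMem hx]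
      obtain ⟨i, hi, hxi⟩ : ∃ i ∈ s, x i ∉ t i := by simpa [Set.mem_pi] using hx
      rw [Finset.prod_eq_zero hi (by simp [hxi]), zero_mul]
  simp_rw [hprod]
  rw [lintegral_prod_eq_prod_lintegral_of_indepFun (s ∪ F) (fun i (x : ∀ i, Ω i) => φ i (x i))
    (iIndepFun_infinitePi hφ) (fun i => (hφ i).comp (measurable_pi_apply i))]
  have hν : ∀ i, ∀ u : Set (Ω i), MeasurableSet u →
      ∫⁻ y, u.indicator 1 y * (if i ∈ F then f i y else 1) ∂(μ i) = ν i u := by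
    intro i u hu
    have : ∀ y, u.indicator 1 y * (if i ∈ F then f i y else 1)
        = u.indicator (fun y => if i ∈ F then f i y else 1) y := by
      intro y
      by_cases hy : y ∈ u <;> simp [hy]
    simp_rw [this]
    rw [lintegral_indicator hu]
    by_cases hi : i ∈ F
    · simp [hi, hF i hi, withDensity_apply _ hu]
    · simp [hi, hFc i hi]
  have hfac : ∀ i, ∫⁻ x : (∀ i, Ω i), φ i (x i) ∂(infinitePi μ) =
      if i ∈ s then ν i (t i) else 1 := by
    intro i
    rw [← lintegral_map (hφ i) (measurable_pi_apply i), infinitePi_map_eval]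
    by_cases hi : i ∈ s
    · simpa [φ, hi] using hν i (t i) (ht i)
    · simpa [φ, hi] using hν i Set.univ MeasurableSet.univ
  simp_rw [hfac]
  rw [Finset.prod_ite_mem, Finset.union_inter_cancel_left]

/-- This is `(x - 2 * a) ^ 2 ≥ 0`. Applied to a density, it bounds a probability linearly by the
other probability plus a second moment, with `a` balancing the two. -/
theorem _root_.ENNReal.le_add_sq_div (a x : ℝ≥0∞) (ha : a ≠ 0) (ha' : a ≠ ⊤) :
    x ≤ a + (4 * a)⁻¹ * x ^ 2 := by
  have h4 : (4 * a)⁻¹ ≠ 0 := ENNReal.inv_ne_zero.2 (ENNReal.mul_ne_top (by simp) ha')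
  have h4' : (4 * a)⁻¹ ≠ ⊤ := ENNReal.inv_ne_top.2 (mul_ne_zero (by simp) ha)
  rcases eq_or_ne x ⊤ with rfl | hx
  · simp [ENNReal.mul_top h4]
  · rw [← ENNReal.toReal_le_toReal hx (by finiteness), ENNReal.toReal_add ha' (by finiteness)]
    have hpos : 0 < a.toReal := ENNReal.toReal_pos ha ha'
    simp only [ENNReal.toReal_mul, ENNReal.toReal_inv, ENNReal.toReal_pow, ENNReal.toReal_ofNat]
    have : a.toReal + (4 * a.toReal)⁻¹ * x.toReal ^ 2 - x.toReal
        = (4 * a.toReal)⁻¹ * (x.toReal - 2 * a.toReal) ^ 2 := by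
      field_simp
      ring
    have : 0 ≤ (4 * a.toReal)⁻¹ * (x.toReal - 2 * a.toReal) ^ 2 := by positivity
    linarith

/-- Change of measure in finitely many factors of a product measure, in terms of the second moments
of the densities. -/
theorem infinitePi_le_of_withDensity {Ω : ι → Type*} [∀ i, MeasurableSpace (Ω i)]
    (μ ν : ∀ i, Measure (Ω i)) [∀ i, IsProbabilityMeasure (μ i)] [∀ i, IsProbabilityMeasure (ν i)]
    (F : Finset ι) (f : ∀ i, Ω i → ℝ≥0∞) (hf : ∀ i, Measurable (f i))
    (hF : ∀ i ∈ F, ν i = (μ i).withDensity (f i)) (hFc : ∀ i ∉ F, ν i = μ i)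
    {a : ℝ≥0∞} (ha : a ≠ 0) (ha' : a ≠ ⊤) {E : Set (∀ i, Ω i)} (hE : MeasurableSet E) :
    infinitePi ν E ≤ a * infinitePi μ E + (4 * a)⁻¹ * ∏ i ∈ F, ∫⁻ y, f i y ^ 2 ∂(μ i) := by
  have hm : ∀ i, Measurable fun x : ∀ i, Ω i => f i (x i) ^ 2 := fun i =>
    ((hf i).comp (measurable_pi_apply i)).pow_const 2
  have hmp : Measurable fun x : ∀ i, Ω i => (∏ i ∈ F, f i (x i)) ^ 2 :=
    (Finset.measurable_fun_prod F fun i _ => (hf i).comp (measurable_pi_apply i)).pow_const 2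
  have hsq : ∫⁻ x, (∏ i ∈ F, f i (x i)) ^ 2 ∂(infinitePi μ) =
      ∏ i ∈ F, ∫⁻ y, f i y ^ 2 ∂(μ i) := by
    simp_rw [← Finset.prod_pow]
    rw [lintegral_prod_eq_prod_lintegral_of_indepFun F (fun i (x : ∀ i, Ω i) => f i (x i) ^ 2)
      (iIndepFun_infinitePi (X := fun i y => f i y ^ 2) fun i => (hf i).pow_const 2) hm]
    refine Finset.prod_congr rfl fun i _ => ?_
    rw [← lintegral_map (f := fun y => f i y ^ 2) ((hf i).pow_const 2) (measurable_pi_apply i),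
      infinitePi_map_eval]
  rw [infinitePi_eq_withDensity μ ν F f hf hF hFc, withDensity_apply _ hE, ← hsq]
  calc ∫⁻ x in E, ∏ i ∈ F, f i (x i) ∂(infinitePi μ)
      ≤ ∫⁻ x in E, (a + (4 * a)⁻¹ * (∏ i ∈ F, f i (x i)) ^ 2) ∂(infinitePi μ) :=
        lintegral_mono fun x => ENNReal.le_add_sq_div a _ ha ha'
    _ = a * infinitePi μ E +
        ∫⁻ x in E, (4 * a)⁻¹ * (∏ i ∈ F, f i (x i)) ^ 2 ∂(infinitePi μ) := by
        rw [lintegral_add_left measurable_const, setLIntegral_const]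
    _ ≤ a * infinitePi μ E + (4 * a)⁻¹ * ∫⁻ x, (∏ i ∈ F, f i (x i)) ^ 2 ∂(infinitePi μ) := by
        gcongr
        rw [← lintegral_const_mul _ hmp]
        exact setLIntegral_le_lintegral _ _

/-- The version of `infinitePi_le_of_withDensity` for an event that depends only on the coordinates
in `I`: the factors outside `I` are arbitrary. -/
theorem infinitePi_le_of_withDensity_of_dependsOn {Ω : Type*} [MeasurableSpace Ω]
    (μ ν : ι → Measure Ω) [∀ i, IsProbabilityMeasure (μ i)] [∀ i, IsProbabilityMeasure (ν i)]
    (I : Set ι) (F : Finset ι) (hFI : ↑F ⊆ I) (f : ι → Ω → ℝ≥0∞) (hf : ∀ i, Measurable (f i))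
    (hF : ∀ i ∈ F, ν i = (μ i).withDensity (f i)) (hFc : ∀ i ∈ I, i ∉ F → ν i = μ i)
    {a : ℝ≥0∞} (ha : a ≠ 0) (ha' : a ≠ ⊤) {E : Set (ι → Ω)} (hE : MeasurableSet E)
    (hEI : ∀ x y : ι → Ω, (∀ i ∈ I, x i = y i) → x ∈ E → y ∈ E) :
    infinitePi ν E ≤ a * infinitePi μ E + (4 * a)⁻¹ * ∏ i ∈ F, ∫⁻ y, f i y ^ 2 ∂(μ i) := by
  classical
  rcases isEmpty_or_nonempty ι with hι | ⟨⟨i₀⟩⟩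
  · refine infinitePi_le_of_withDensity μ ν F f hf hF (fun i => hι.elim i) ha ha' hE
  obtain ⟨c⟩ : Nonempty Ω := (μ i₀).nonempty_of_neZero
  -- Freezing the coordinates outside `I` at `c` leaves `E` unchanged and turns their laws into the
  -- same Dirac mass, so the two products then differ only on the finite set `F`.
  let g : ι → Ω → Ω := fun i y => if i ∈ I then y else c
  have hg : ∀ i, Measurable (g i) := by
    intro i
    by_cases hi : i ∈ I
    · simpa [g, hi] using measurable_id'
    · simp [g, hi]
  have hgm : Measurable fun (x : ι → Ω) i => g i (x i) :=
    measurable_pi_lambda _ fun i => (hg i).comp (measurable_pi_apply i)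
  have hpre : (fun (x : ι → Ω) i => g i (x i)) ⁻¹' E = E := by
    ext x
    have h : ∀ i ∈ I, g i (x i) = x i := fun i hi => by simp [g, hi]
    exact ⟨fun hx => hEI _ _ h hx, fun hx => hEI _ _ (fun i hi => (h i hi).symm) hx⟩
  have hμ : ∀ i, IsProbabilityMeasure ((μ i).map (g i)) := fun i =>
    isProbabilityMeasure_map (hg i).aemeasurable
  have hν : ∀ i, IsProbabilityMeasure ((ν i).map (g i)) := fun i =>
    isProbabilityMeasure_map (hg i).aemeasurable
  have hmem : ∀ (ρ : ι → Measure Ω), ∀ i ∈ I, (ρ i).map (g i) = ρ i := fun ρ i hi => by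
    have : g i = id := by
      ext y
      simp [g, hi]
    rw [this, map_id]
  have hnot : ∀ (ρ : ι → Measure Ω) [∀ i, IsProbabilityMeasure (ρ i)], ∀ i ∉ I,
      (ρ i).map (g i) = dirac c := fun ρ _ i hi => by
    have : g i = fun _ => c := by
      ext y
      simp [g, hi]
    rw [this, map_const, measure_univ, one_smul]
  have key := infinitePi_le_of_withDensity (fun i => (μ i).map (g i)) (fun i => (ν i).map (g i)) F f
    hf (fun i hi => by rw [hmem μ i (hFI hi), hmem ν i (hFI hi), hF i hi])
    (fun i hi => by
      by_cases hiI : i ∈ I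
      · rw [hmem μ i hiI, hmem ν i hiI, hFc i hiI hi]
      · rw [hnot μ i hiI, hnot ν i hiI]) ha ha' hE
  rw [← infinitePi_map_pi μ hg, ← infinitePi_map_pi ν hg, map_apply hgm hE, map_apply hgm hE,
    hpre] at key
  refine key.trans_eq ?_
  congr 2
  exact Finset.prod_congr rfl fun i hi => by rw [hmem μ i (hFI hi)]

end MeasureTheory.Measure

/-! ### Densities between Bernoulli laws. -/

/-- The density of the fair Bernoulli law on `{0, 1} ⊆ [0, 1]` with respect to the one with mean
`q`. -/
noncomputable def fairDensity (q : unitInterval) (x : unitInterval) : ENNReal :=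
  ENNReal.ofReal (if x = 1 then 1 / (2 * (q : ℝ)) else 1 / (2 * (1 - q)))

theorem measurable_fairDensity (q : unitInterval) : Measurable (fairDensity q) :=
  ENNReal.measurable_ofReal.comp
    (Measurable.ite (measurableSet_singleton 1) measurable_const measurable_const)

theorem lintegral_bernoulliMeasure_unitInterval (q : unitInterval) (f : unitInterval → ENNReal) :
    ∫⁻ x, f x ∂(bernoulliMeasure (1 : unitInterval) 0 q) =
      ENNReal.ofReal q * f 1 + ENNReal.ofReal (1 - q) * f 0 := by
  have h1 : ((unitInterval.toNNReal q : NNReal) : ENNReal) = ENNReal.ofReal q := by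
    rw [← ENNReal.ofReal_coe_nnreal]; rfl
  have h2 : ((unitInterval.toNNReal (unitInterval.symm q) : NNReal) : ENNReal)
      = ENNReal.ofReal (1 - q) := by
    rw [← ENNReal.ofReal_coe_nnreal]; rfl
  rw [bernoulliMeasure_def, lintegral_add_measure]
  simp only [lintegral_smul_measure, lintegral_dirac, ← h1, ← h2]
  rfl

theorem bernoulliMeasure_half_eq_withDensity {p q : unitInterval} (hp : (p : ℝ) = 1 / 2)
    (hq0 : 0 < (q : ℝ)) (hq1 : (q : ℝ) < 1) :
    bernoulliMeasure (1 : unitInterval) 0 p =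
      (bernoulliMeasure (1 : unitInterval) 0 q).withDensity (fairDensity q) := by
  ext s hs
  have h1q : 0 < 1 - (q : ℝ) := by linarith
  have h1 : ENNReal.ofReal q * fairDensity q 1 = ENNReal.ofReal (1 / 2) := by
    rw [fairDensity, if_pos rfl, ← ENNReal.ofReal_mul hq0.le]
    congr 1
    field_simp
  have h0 : ENNReal.ofReal (1 - q) * fairDensity q 0 = ENNReal.ofReal (1 / 2) := by
    rw [fairDensity, if_neg zero_ne_one, ← ENNReal.ofReal_mul h1q.le]
    congr 1
    field_simp
  have hps := lintegral_bernoulliMeasure_unitInterval p (s.indicator 1)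
  rw [lintegral_indicator_one hs] at hps
  rw [withDensity_apply _ hs, ← lintegral_indicator hs, lintegral_bernoulliMeasure_unitInterval,
    hps, hp, show (1 : ℝ) - 1 / 2 = 1 / 2 by norm_num]
  congr 1
  · by_cases h : (1 : unitInterval) ∈ s <;> simp only [h, Set.indicator_of_mem,
      Set.indicator_of_notMem, not_false_eq_true, mul_zero, Pi.one_apply, mul_one, h1]
  · by_cases h : (0 : unitInterval) ∈ s <;> simp only [h, Set.indicator_of_mem,
      Set.indicator_of_notMem, not_false_eq_true, mul_zero, Pi.one_apply, mul_one, h0]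

/-- The two atoms contribute `1 / (4 * q) + 1 / (4 * (1 - q)) = 1 / (4 * q * (1 - q))`. -/
theorem lintegral_fairDensity_sq {q : unitInterval} {ε : ℝ} (hε : 0 < ε) (hε' : ε < 1 / 2)
    (hq : (q : ℝ) = 1 / 2 + ε) :
    ∫⁻ x, fairDensity q x ^ 2 ∂(bernoulliMeasure (1 : unitInterval) 0 q) =
      ENNReal.ofReal (1 / (1 - 4 * ε ^ 2)) := by
  have hA : (0 : ℝ) < 1 / 2 + ε := by linarith
  have hB : (0 : ℝ) < 1 - (1 / 2 + ε) := by linarith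
  rw [lintegral_bernoulliMeasure_unitInterval, fairDensity, fairDensity, if_pos rfl,
    if_neg zero_ne_one, hq, ← ENNReal.ofReal_pow (by positivity),
    ← ENNReal.ofReal_pow (by positivity), ← ENNReal.ofReal_mul (by positivity),
    ← ENNReal.ofReal_mul (by positivity), ← ENNReal.ofReal_add (by positivity) (by positivity)]
  congr 1
  have hC : (1 - 4 * ε ^ 2) = 4 * (1 / 2 + ε) * (1 - (1 / 2 + ε)) := by ring
  rw [hC]
  generalize hu : 1 / 2 + ε = u at *
  obtain ⟨v, hv⟩ : ∃ v, v = 1 - u := ⟨_, rfl⟩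
  rw [← hv] at hB ⊢
  have huv : u + v = 1 := by linarith
  field_simp
  linarith

theorem MeasurableSet.setOf_comp_countable {Ω α : Type*} [MeasurableSpace Ω] [Countable α]
    {σ : Ω → α} (hσ : ∀ a, MeasurableSet {ω | σ ω = a}) {P : α → Ω → Prop}
    (hP : ∀ a, MeasurableSet {ω | P a ω}) : MeasurableSet {ω | P (σ ω) ω} := by
  have : {ω | P (σ ω) ω} = ⋃ a, {ω | σ ω = a} ∩ {ω | P a ω} := by
    ext ω
    simp
  rw [this]
  exact .iUnion fun a => (hσ a).inter (hP a)

/-! ### Runs for a fixed seed: pull counts, batches and transcripts. -/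

namespace RoundState

variable {K : ℕ} {M : Type*}

instance [Countable M] : Countable (RoundState K M) := by
  have : Function.Injective fun s : RoundState K M =>
      (s.batch, s.start, s.finish, s.anchor, s.mem, s.pulls) := by
    rintro ⟨⟩ ⟨⟩ h
    simp_all
  exact this.countable

/-- The part of the situation that determines the arms pulled in the running batch. -/
def schedule (s : RoundState K M) : ℕ × ℕ × ℕ × M := (s.batch, s.start, s.finish, s.anchor)

end RoundState

namespace BatchedBandit

variable {K T B : ℕ} {M Seed : Type*} [MeasurableSpace M] [MeasurableSpace Seed]
  (alg : BatchedBandit K T B M Seed) (u : Seed) (X : Fin K × ℕ → unitInterval)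

/-- The persistent state after round `t + 1`, played in the situation `s`. -/
def nextMem (t : ℕ) (s : RoundState K M) : M :=
  alg.update (t + 1) (s.mem, u, alg.armAt u (t + 1) s,
    X (alg.armAt u (t + 1) s, s.pulls (alg.armAt u (t + 1) s)))

theorem stateAfter_succ (t : ℕ) :
    alg.stateAfter u X (t + 1) =
      if t + 1 = (alg.stateAfter u X t).finish then
        alg.beginBatch u ((alg.stateAfter u X t).batch + 1) (t + 1)
          (alg.nextMem u X t (alg.stateAfter u X t))
          (Function.update (alg.stateAfter u X t).pulls (alg.action u X t)
            ((alg.stateAfter u X t).pulls (alg.action u X t) + 1))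
      else
        { alg.stateAfter u X t with
          mem := alg.nextMem u X t (alg.stateAfter u X t)
          pulls := Function.update (alg.stateAfter u X t).pulls (alg.action u X t)
            ((alg.stateAfter u X t).pulls (alg.action u X t) + 1) } := rfl

theorem pulls_succ (t : ℕ) :
    (alg.stateAfter u X (t + 1)).pulls = Function.update (alg.stateAfter u X t).pulls
      (alg.action u X t) ((alg.stateAfter u X t).pulls (alg.action u X t) + 1) := by
  rw [stateAfter_succ]
  split_ifs <;> rfl

theorem pulls_eq_card (n : ℕ) (i : Fin K) :
    (alg.stateAfter u X n).pulls i =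
      ((Finset.range n).filter fun t => alg.action u X t = i).card := by
  induction n with
  | zero => rfl
  | succ n ih =>
    rw [pulls_succ, Finset.range_add_one, Finset.filter_insert]
    split_ifs with h
    · rw [Finset.card_insert_of_notMem (by simp), ← ih, h, Function.update_self]
    · rw [Function.update_of_ne (Ne.symm h), ih]

theorem pulls_le_pulls_succ (t : ℕ) (i : Fin K) :
    (alg.stateAfter u X t).pulls i ≤ (alg.stateAfter u X (t + 1)).pulls i := by
  rw [pulls_eq_card, pulls_eq_card]
  exact Finset.card_le_card (Finset.filter_subset_filter _ (Finset.range_mono t.le_succ))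

/-- As long as arm `i` has been pulled at most `m` times, only its first `m` rewards matter. -/
theorem stateAfter_eq_of_pulls_le {X' : Fin K × ℕ → unitInterval} {i : Fin K} {m : ℕ}
    (h : ∀ p : Fin K × ℕ, (p.1 = i → p.2 < m) → X p = X' p) (t : ℕ)
    (ht : (alg.stateAfter u X t).pulls i ≤ m) :
    alg.stateAfter u X t = alg.stateAfter u X' t := by
  induction t with
  | zero => rfl
  | succ t ih =>
    have hs := ih ((alg.pulls_le_pulls_succ u X t i).trans ht)
    have hX : X (alg.armAt u (t + 1) (alg.stateAfter u X' t),
          (alg.stateAfter u X' t).pulls (alg.armAt u (t + 1) (alg.stateAfter u X' t))) =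
        X' (alg.armAt u (t + 1) (alg.stateAfter u X' t),
          (alg.stateAfter u X' t).pulls (alg.armAt u (t + 1) (alg.stateAfter u X' t))) := by
      -- If arm `i` is pulled now, the entry read has index `pulls i` before the round, which is
      -- below `m` since the count after the round is at most `m`.
      refine h _ fun hi => ?_
      rw [pulls_succ, action, hs] at ht
      simp only at hi
      rw [hi, Function.update_self] at ht
      rw [hi]
      exact ht
    rw [stateAfter_succ, stateAfter_succ, action, action, hs, nextMem, nextMem, hX]

theorem finish_beginBatch_of_le {b s : ℕ} {m : M} {N : Fin K → ℕ} (hb : B ≤ b) :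
    (alg.beginBatch u b s m N).finish = T := if_neg hb.not_gt

/-- Batch `B` lasts until `T`, so no earlier round can close it; the bound on `batch` needs the
claim on `finish` in the same induction. -/
theorem batch_bounds (hB : 0 < B) (t : ℕ) :
    0 < (alg.stateAfter u X t).batch ∧
      (B ≤ (alg.stateAfter u X t).batch → (alg.stateAfter u X t).finish = T) ∧
      (t < T → (alg.stateAfter u X t).batch ≤ B) := by
  induction t with
  | zero => exact ⟨Nat.one_pos, alg.finish_beginBatch_of_le u, fun _ => hB⟩
  | succ t ih =>
    obtain ⟨h0, h1, h2⟩ := ih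
    rw [stateAfter_succ]
    split_ifs with h
    · refine ⟨Nat.succ_pos _, alg.finish_beginBatch_of_le u, fun ht => ?_⟩
      have h3 := h2 (by omega)
      rcases h3.lt_or_eq with h4 | h4
      · exact h4
      · have := h1 h4.ge
        omega
    · exact ⟨h0, h1, fun ht => h2 (by omega)⟩

/-- `anchor` is rewritten only when `batch` increases, so the batch number identifies it. This makes
the arbitrary choice of round in `transcript` harmless. -/
theorem anchor_eq_of_batch_eq_of_le {t t' : ℕ} (htt : t ≤ t') :
    (alg.stateAfter u X t).batch ≤ (alg.stateAfter u X t').batch ∧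
      ((alg.stateAfter u X t).batch = (alg.stateAfter u X t').batch →
        (alg.stateAfter u X t).anchor = (alg.stateAfter u X t').anchor) := by
  induction t', htt using Nat.le_induction with
  | base => exact ⟨le_rfl, fun _ => rfl⟩
  | succ n hn ih =>
    obtain ⟨h1, h2⟩ := ih
    rw [stateAfter_succ]
    split_ifs with h
    · refine ⟨h1.trans (Nat.le_succ _), fun h3 => ?_⟩
      change _ = (alg.stateAfter u X n).batch + 1 at h3
      omega
    · exact ⟨h1, h2⟩

theorem anchor_eq_of_batch_eq {t t' : ℕ}
    (h : (alg.stateAfter u X t).batch = (alg.stateAfter u X t').batch) :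
    (alg.stateAfter u X t).anchor = (alg.stateAfter u X t').anchor := by
  rcases le_total t t' with htt | htt
  · exact (alg.anchor_eq_of_batch_eq_of_le u X htt).2 h
  · exact ((alg.anchor_eq_of_batch_eq_of_le u X htt).2 h.symm).symm

/-- The persistent state at the beginning of batch `b`, if that batch takes place. -/
noncomputable def transcript (b : ℕ) : M :=
  open Classical in
  if h : ∃ t, (alg.stateAfter u X t).batch = b then (alg.stateAfter u X h.choose).anchor
  -- A dummy value: the induction on schedules uses transcripts only at batch numbers that occur in
  -- both runs.
  else alg.init

theorem transcript_batch (t : ℕ) :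
    alg.transcript u X (alg.stateAfter u X t).batch = (alg.stateAfter u X t).anchor := by
  have h : ∃ t', (alg.stateAfter u X t').batch = (alg.stateAfter u X t).batch := ⟨t, rfl⟩
  rw [transcript, dif_pos h]
  exact alg.anchor_eq_of_batch_eq u X h.choose_spec

/-- The persistent states at the beginnings of the batches determine the schedule. -/
theorem schedule_eq_of_transcript_eq (hB : 0 < B) {X' : Fin K × ℕ → unitInterval}
    (h : ∀ b : Fin B, alg.transcript u X (b + 1) = alg.transcript u X' (b + 1)) (t : ℕ)
    (ht : t < T) : (alg.stateAfter u X t).schedule = (alg.stateAfter u X' t).schedule := by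
  induction t with
  | zero => rfl
  | succ t ih =>
    have hs := ih (by omega)
    -- With equal schedules both runs close a batch in the same round, so only the new anchor could
    -- differ, and the transcript fixes it. Batches count from `1`, `Fin B` from `0`.
    have hanchor : (alg.stateAfter u X (t + 1)).batch = (alg.stateAfter u X' (t + 1)).batch →
        (alg.stateAfter u X (t + 1)).anchor = (alg.stateAfter u X' (t + 1)).anchor := by
      intro hb
      obtain ⟨h0, -, h2⟩ := alg.batch_bounds u X hB (t + 1)
      have h2 := h2 ht
      have h3 := h ⟨(alg.stateAfter u X (t + 1)).batch - 1, by omega⟩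
      simp only [Nat.sub_add_cancel h0] at h3
      rw [transcript_batch, hb, transcript_batch] at h3
      exact h3
    obtain ⟨hbatch, hstart, hfinish, hanc⟩ :
        (alg.stateAfter u X t).batch = (alg.stateAfter u X' t).batch ∧
        (alg.stateAfter u X t).start = (alg.stateAfter u X' t).start ∧
        (alg.stateAfter u X t).finish = (alg.stateAfter u X' t).finish ∧
        (alg.stateAfter u X t).anchor = (alg.stateAfter u X' t).anchor := by
      simpa [RoundState.schedule] using hs
    rw [stateAfter_succ, stateAfter_succ, hfinish] at hanchor ⊢
    split_ifs at hanchor ⊢ with hf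
    · simp only [RoundState.schedule, beginBatch, hbatch] at hanchor ⊢
      rw [hanchor trivial]
    · exact hs

theorem pulls_eq_of_transcript_eq (hB : 0 < B) {X' : Fin K × ℕ → unitInterval}
    (h : ∀ b : Fin B, alg.transcript u X (b + 1) = alg.transcript u X' (b + 1)) :
    (alg.stateAfter u X T).pulls = (alg.stateAfter u X' T).pulls := by
  ext i
  rw [pulls_eq_card, pulls_eq_card]
  congr 1
  refine Finset.filter_congr fun t ht => ?_
  have hs := alg.schedule_eq_of_transcript_eq u X hB h t (Finset.mem_range.1 ht)
  simp only [RoundState.schedule, Prod.mk.injEq] at hs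
  obtain ⟨hbatch, hstart, -, hanc⟩ := hs
  rw [action, action, armAt, armAt, hbatch, hstart, hanc]

/-- For a fixed seed, there are at most `|M| ^ B` possible vectors of numbers of pulls. -/
theorem exists_finset_pulls_mem [Fintype M] (hB : 0 < B) :
    ∃ 𝒩 : Finset (Fin K → ℕ), 𝒩.card ≤ Fintype.card M ^ B ∧
      ∀ X, (alg.stateAfter u X T).pulls ∈ 𝒩 := by
  classical
  let τ : (Fin K × ℕ → unitInterval) → Fin B → M := fun X b => alg.transcript u X (b + 1)
  let N : (Fin K × ℕ → unitInterval) → Fin K → ℕ := fun X => (alg.stateAfter u X T).pulls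
  have hN : Function.FactorsThrough N τ := fun X X' h =>
    alg.pulls_eq_of_transcript_eq u X hB fun b => congrFun h b
  refine ⟨Finset.univ.image (Function.extend τ N 0), ?_, fun X => ?_⟩
  · refine Finset.card_image_le.trans ?_
    simp
  · rw [Finset.mem_image]
    exact ⟨τ X, Finset.mem_univ _, hN.extend_apply 0 X⟩

/-! ### Measurability of the run. -/

section Measurability

variable [Countable M] [DiscreteMeasurableSpace M]

/-- Situation, arm and new memory take countably many values. Fixing them one after another leaves
only `boundary`, `plan` and `update` with the other arguments constant or measurable. -/
theorem measurableSet_stateAfter_eq (t : ℕ) (s : RoundState K M) :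
    MeasurableSet {ω : Seed × (Fin K × ℕ → unitInterval) | alg.stateAfter ω.1 ω.2 t = s} := by
  have hboundary : ∀ b r m n, MeasurableSet
      {ω : Seed × (Fin K × ℕ → unitInterval) | alg.boundary b (r, m, ω.1) = n} := fun b r m n =>
    ((alg.measurable_boundary b).comp (by fun_prop :
      Measurable fun ω : Seed × (Fin K × ℕ → unitInterval) => (r, m, ω.1)))
      (measurableSet_singleton n)
  have hbegin : ∀ b r m N s', MeasurableSet
      {ω : Seed × (Fin K × ℕ → unitInterval) | alg.beginBatch ω.1 b r m N = s'} := by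
    intro b r m N s'
    exact MeasurableSet.setOf_comp_countable (hboundary b r m)
      (P := fun n _ => RoundState.mk b r (if b < B then n else T) m m N = s')
      fun n => MeasurableSet.const _
  induction t generalizing s with
  | zero => exact hbegin _ _ _ _ _
  | succ t ih =>
    refine MeasurableSet.setOf_comp_countable ih
      (P := fun s' ω =>
        (if t + 1 = s'.finish then
          alg.beginBatch ω.1 (s'.batch + 1) (t + 1)
            (alg.update (t + 1) (s'.mem, ω.1, alg.armAt ω.1 (t + 1) s',
              ω.2 (alg.armAt ω.1 (t + 1) s', s'.pulls (alg.armAt ω.1 (t + 1) s'))))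
            (Function.update s'.pulls (alg.armAt ω.1 (t + 1) s')
              (s'.pulls (alg.armAt ω.1 (t + 1) s') + 1))
        else
          { s' with
            mem := alg.update (t + 1) (s'.mem, ω.1, alg.armAt ω.1 (t + 1) s',
              ω.2 (alg.armAt ω.1 (t + 1) s', s'.pulls (alg.armAt ω.1 (t + 1) s')))
            pulls := Function.update s'.pulls (alg.armAt ω.1 (t + 1) s')
              (s'.pulls (alg.armAt ω.1 (t + 1) s') + 1) }) = s) fun s' => ?_
    have harm : ∀ a, MeasurableSet
        {ω : Seed × (Fin K × ℕ → unitInterval) | alg.armAt ω.1 (t + 1) s' = a} := fun a =>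
      ((alg.measurable_plan s'.batch (t + 1)).comp (by fun_prop :
        Measurable fun ω : Seed × (Fin K × ℕ → unitInterval) => (s'.start, s'.anchor, ω.1)))
        (measurableSet_singleton a)
    refine MeasurableSet.setOf_comp_countable harm
      (P := fun a ω =>
        (if t + 1 = s'.finish then
          alg.beginBatch ω.1 (s'.batch + 1) (t + 1)
            (alg.update (t + 1) (s'.mem, ω.1, a, ω.2 (a, s'.pulls a)))
            (Function.update s'.pulls a (s'.pulls a + 1))
        else
          { s' with
            mem := alg.update (t + 1) (s'.mem, ω.1, a, ω.2 (a, s'.pulls a))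
            pulls := Function.update s'.pulls a (s'.pulls a + 1) }) = s) fun a => ?_
    have hmem : ∀ m, MeasurableSet {ω : Seed × (Fin K × ℕ → unitInterval) |
        alg.update (t + 1) (s'.mem, ω.1, a, ω.2 (a, s'.pulls a)) = m} := fun m =>
      ((alg.measurable_update (t + 1)).comp (by fun_prop :
        Measurable fun ω : Seed × (Fin K × ℕ → unitInterval) =>
          (s'.mem, ω.1, a, ω.2 (a, s'.pulls a))))
        (measurableSet_singleton m)
    refine MeasurableSet.setOf_comp_countable hmem
      (P := fun m ω =>
        (if t + 1 = s'.finish then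
          alg.beginBatch ω.1 (s'.batch + 1) (t + 1) m
            (Function.update s'.pulls a (s'.pulls a + 1))
        else
          { s' with
            mem := m
            pulls := Function.update s'.pulls a (s'.pulls a + 1) }) = s) fun m => ?_
    split_ifs
    · exact hbegin _ _ _ _ _
    · exact MeasurableSet.const _

theorem measurable_pulls (t : ℕ) (i : Fin K) :
    Measurable fun ω : Seed × (Fin K × ℕ → unitInterval) =>
      (alg.stateAfter ω.1 ω.2 t).pulls i :=
  measurable_to_countable' fun n =>
    MeasurableSet.setOf_comp_countable (alg.measurableSet_stateAfter_eq t)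
      (P := fun s _ => s.pulls i = n) fun _ => MeasurableSet.const _

theorem measurable_action (t : ℕ) :
    Measurable fun ω : Seed × (Fin K × ℕ → unitInterval) => alg.action ω.1 ω.2 t :=
  measurable_to_countable' fun a =>
    MeasurableSet.setOf_comp_countable (alg.measurableSet_stateAfter_eq t)
      (P := fun s ω => alg.armAt ω.1 (t + 1) s = a) fun s =>
        ((alg.measurable_plan s.batch (t + 1)).comp (by fun_prop :
          Measurable fun ω : Seed × (Fin K × ℕ → unitInterval) => (s.start, s.anchor, ω.1)))
          (measurableSet_singleton a)

end Measurability

end BatchedBandit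

/-! ### The two-level Bernoulli instances. -/

namespace BanditInstance

variable {K : ℕ}

/-- The Bernoulli instance with means `p`. -/
noncomputable def bernoulli (p : Fin K → unitInterval) : BanditInstance K :=
  fun i => ⟨bernoulliMeasure (1 : unitInterval) 0 (p i), inferInstance⟩

theorem coe_bernoulli (p : Fin K → unitInterval) (i : Fin K) :
    (bernoulli p i : Measure unitInterval) = bernoulliMeasure (1 : unitInterval) 0 (p i) := rfl

theorem bernoulli_mem_bernoulliClass (p : Fin K → unitInterval) :
    bernoulli p ∈ bernoulliClass K := ⟨p, fun _ => rfl⟩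

theorem mean_bernoulli (p : Fin K → unitInterval) (i : Fin K) : (bernoulli p).mean i = p i := by
  rw [mean, coe_bernoulli, integral_bernoulliMeasure]
  simp

theorem mean_le_bestMean (ν : BanditInstance K) (i : Fin K) : ν.mean i ≤ ν.bestMean :=
  le_ciSup (Set.finite_range ν.mean).bddAbove i

/-- The arms in `S` have mean `1 / 2`, the others have mean `1 / 4`. -/
noncomputable def twoLevelMean (S : Finset (Fin K)) (i : Fin K) : unitInterval :=
  if i ∈ S then ⟨1 / 2, by norm_num, by norm_num⟩ else ⟨1 / 4, by norm_num, by norm_num⟩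

theorem twoLevelMean_of_mem {S : Finset (Fin K)} {i : Fin K} (hi : i ∈ S) :
    (twoLevelMean S i : ℝ) = 1 / 2 := by simp [twoLevelMean, hi]

theorem twoLevelMean_of_notMem {S : Finset (Fin K)} {i : Fin K} (hi : i ∉ S) :
    (twoLevelMean S i : ℝ) = 1 / 4 := by simp [twoLevelMean, hi]

theorem twoLevelMean_le (S : Finset (Fin K)) (i : Fin K) : (twoLevelMean S i : ℝ) ≤ 1 / 2 := by
  by_cases hi : i ∈ S
  · rw [twoLevelMean_of_mem hi]
  · rw [twoLevelMean_of_notMem hi]; norm_num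

end BanditInstance

/-! ### Small regret makes the heavy arms approximate `S`. -/

namespace BatchedBandit

variable {K T B : ℕ} {M Seed : Type*} [MeasurableSpace M] [MeasurableSpace Seed]
  (alg : BatchedBandit K T B M Seed)

instance : IsProbabilityMeasure alg.seedLaw := alg.isProbabilityMeasure_seedLaw

instance (ν : BanditInstance K) : IsProbabilityMeasure (alg.lawUnder ν) := by
  unfold lawUnder
  infer_instance

/-- The arms pulled at least `m` times. -/
def heavyArms (m : ℕ) (u : Seed) (X : Fin K × ℕ → unitInterval) : Finset (Fin K) :=
  Finset.univ.filter fun i => m ≤ (alg.stateAfter u X T).pulls i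

theorem mem_heavyArms {m : ℕ} {u : Seed} {X : Fin K × ℕ → unitInterval} {i : Fin K} :
    i ∈ alg.heavyArms m u X ↔ m ≤ (alg.stateAfter u X T).pulls i := by simp [heavyArms]

theorem card_symmDiff_heavyArms (m : ℕ) (S : Finset (Fin K))
    (ω : Seed × (Fin K × ℕ → unitInterval)) :
    ((symmDiff S (alg.heavyArms m ω.1 ω.2)).card : ℝ) =
      ∑ i ∈ S, {ω : Seed × (Fin K × ℕ → unitInterval) |
        i ∉ alg.heavyArms m ω.1 ω.2}.indicator (fun _ => (1 : ℝ)) ω +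
      ∑ i ∈ Sᶜ, {ω : Seed × (Fin K × ℕ → unitInterval) |
        i ∈ alg.heavyArms m ω.1 ω.2}.indicator (fun _ => (1 : ℝ)) ω := by
  simp only [Set.indicator_apply, Set.mem_ofPred_eq, Finset.sum_boole]
  rw [symmDiff_def, Finset.sup_eq_union, Finset.card_union_of_disjoint disjoint_sdiff_sdiff]
  push_cast
  congr 3
  · ext i; simp
  · ext i; simp [and_comm]

section Measurability

variable [Countable M] [DiscreteMeasurableSpace M]

theorem measurableSet_mem_heavyArms (m : ℕ) (i : Fin K) :
    MeasurableSet {ω : Seed × (Fin K × ℕ → unitInterval) | i ∈ alg.heavyArms m ω.1 ω.2} := by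
  simp_rw [mem_heavyArms]
  exact measurableSet_le measurable_const (alg.measurable_pulls T i)

theorem measurableSet_notMem_heavyArms (m : ℕ) (i : Fin K) :
    MeasurableSet {ω : Seed × (Fin K × ℕ → unitInterval) | i ∉ alg.heavyArms m ω.1 ω.2} :=
  (alg.measurableSet_mem_heavyArms m i).compl

theorem integrable_pseudoRegret (ν : BanditInstance K) :
    Integrable (alg.pseudoRegret ν) (alg.lawUnder ν) := by
  refine integrable_finsetSum _ fun t _ => ?_
  have h : Integrable (fun a : Fin K => ν.bestMean - ν.mean a)
      ((alg.lawUnder ν).map fun ω => alg.action ω.1 ω.2 t) := Integrable.of_finite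
  exact h.comp_measurable (alg.measurable_action t)

/-- Pulling arm `i` fewer than `m` times is unlikely under `P` if it is unlikely under `Q`, when `P`
and `Q` differ only in that the mean of arm `i` is `1 / 2` under `P` and `1 / 2 + ε` under `Q`. -/
theorem lawUnder_notMem_heavyArms_le (p : Fin K → unitInterval) {i : Fin K} {q : unitInterval}
    {ε : ℝ} {m : ℕ} (hε : 0 < ε) (hm : 8 * m * ε ^ 2 ≤ 1) (hε' : ε ≤ 1 / 4)
    (hp : (p i : ℝ) = 1 / 2) (hq : (q : ℝ) = 1 / 2 + ε) :
    (alg.lawUnder (.bernoulli p)).real {ω | i ∉ alg.heavyArms m ω.1 ω.2} ≤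
      64 * (alg.lawUnder (.bernoulli (Function.update p i q))).real
        {ω | i ∉ alg.heavyArms m ω.1 ω.2} + 1 / 128 := by
  classical
  have hE := alg.measurableSet_notMem_heavyArms m i
  set E := {ω : Seed × (Fin K × ℕ → unitInterval) | i ∉ alg.heavyArms m ω.1 ω.2} with hEdef
  set P := Measure.infinitePi fun a : Fin K × ℕ =>
    (BanditInstance.bernoulli p a.1 : Measure unitInterval) with hP
  set Q := Measure.infinitePi fun a : Fin K × ℕ =>
    (BanditInstance.bernoulli (Function.update p i q) a.1 : Measure unitInterval) with hQ
  -- Bernoulli's inequality: `(1 - 4 * ε ^ 2) ^ m ≥ 1 - 4 * m * ε ^ 2 ≥ 1 / 2`.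
  have hpow : ENNReal.ofReal (1 / (1 - 4 * ε ^ 2)) ^ m ≤ 2 := by
    have h1 : 0 < 1 - 4 * ε ^ 2 := by nlinarith
    have h2 : 1 + (m : ℝ) * (-(4 * ε ^ 2)) ≤ (1 + -(4 * ε ^ 2)) ^ m :=
      one_add_mul_le_pow (by nlinarith) m
    have h3 : 1 / 2 ≤ (1 - 4 * ε ^ 2) ^ m := by
      rw [← sub_eq_add_neg] at h2
      nlinarith
    rw [← ENNReal.ofReal_pow (by positivity), ← ENNReal.ofReal_ofNat 2]
    refine ENNReal.ofReal_le_ofReal ?_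
    rw [div_pow, one_pow, div_le_iff₀ (by positivity)]
    linarith
  have hslice : ∀ u, P (Prod.mk u ⁻¹' E) ≤ 64 * Q (Prod.mk u ⁻¹' E) + 128⁻¹ := by
    intro u
    -- Arm `i` has infinitely many entries whose law changes, but a run with fewer than `m` pulls of
    -- it reads only the first `m`. The set of coordinates that matter consists of these and of all
    -- entries of the other arms.
    have key := Measure.infinitePi_le_of_withDensity_of_dependsOn
      (fun a : Fin K × ℕ =>
        (BanditInstance.bernoulli (Function.update p i q) a.1 : Measure unitInterval))
      (fun a : Fin K × ℕ => (BanditInstance.bernoulli p a.1 : Measure unitInterval))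
      {a | a.1 = i → a.2 < m} ({i} ×ˢ Finset.range m)
      (by rintro ⟨j, n⟩ h; simp at h; simp [h])
      (fun _ => fairDensity q) (fun _ => measurable_fairDensity q)
      (by
        rintro ⟨j, n⟩ h
        simp only [Finset.mem_product, Finset.mem_singleton] at h
        simp only [BanditInstance.coe_bernoulli, h.1, Function.update_self]
        exact bernoulliMeasure_half_eq_withDensity hp (by linarith) (by linarith))
      (by
        rintro ⟨j, n⟩ h h'
        have hj : j ≠ i := by
          rintro rfl
          simp at h h'
          omega
        simp [BanditInstance.coe_bernoulli, Function.update_of_ne hj])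
      -- The second moment is at most `2`, so the additive error is `2 / (4 * 64) = 1 / 128`.
      (a := 64) (by simp) (by simp) (hE.preimage measurable_prodMk_left : MeasurableSet
        (Prod.mk u ⁻¹' E))
      (by
        intro X X' h hX
        simp only [hEdef, Set.mem_preimage, Set.mem_ofPred_eq, mem_heavyArms, not_le] at hX ⊢
        rwa [← alg.stateAfter_eq_of_pulls_le u X (X' := X') (i := i) (m := m) h T hX.le])
    refine key.trans ?_
    gcongr
    have hcst : ∀ a ∈ ({i} ×ˢ Finset.range m : Finset (Fin K × ℕ)),
        ∫⁻ y, fairDensity q y ^ 2 ∂(BanditInstance.bernoulli (Function.update p i q) a.1 :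
          Measure unitInterval) = ENNReal.ofReal (1 / (1 - 4 * ε ^ 2)) := by
      rintro ⟨j, n⟩ h
      simp only [Finset.mem_product, Finset.mem_singleton] at h
      simp only [BanditInstance.coe_bernoulli, h.1, Function.update_self]
      exact lintegral_fairDensity_sq hε (by linarith) hq
    rw [Finset.prod_congr rfl hcst, Finset.prod_const, Finset.card_product, Finset.card_singleton,
      Finset.card_range, one_mul]
    calc (4 * 64 : ENNReal)⁻¹ * ENNReal.ofReal (1 / (1 - 4 * ε ^ 2)) ^ m
        ≤ (4 * 64 : ENNReal)⁻¹ * 2 := by gcongr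
      _ = 128⁻¹ := by
        rw [show (4 * 64 : ENNReal) = 128 * 2 by norm_num,
          ENNReal.mul_inv (by simp) (by simp), mul_assoc, ENNReal.inv_mul_cancel (by simp) (by simp),
          mul_one]
  have hmain : alg.lawUnder (.bernoulli p) E ≤
      64 * alg.lawUnder (.bernoulli (Function.update p i q)) E + 128⁻¹ := by
    rw [lawUnder, lawUnder, Measure.prod_apply hE, Measure.prod_apply hE,
      ← lintegral_const_mul _ (measurable_measure_prodMk_left hE)]
    calc _ ≤ ∫⁻ u, (64 * Q (Prod.mk u ⁻¹' E) + 128⁻¹) ∂alg.seedLaw := lintegral_mono hslice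
      _ = _ := by
        rw [lintegral_add_right _ measurable_const, lintegral_const, measure_univ, mul_one]
  have := ENNReal.toReal_mono (by finiteness) hmain
  rw [ENNReal.toReal_add (by finiteness) (by finiteness)] at this
  simpa [measureReal_def] using this

/-- Fewer than `m` pulls of arm `i` leave at least `T + 1 - m` rounds on other arms, each costing at
least `ε`. -/
theorem mul_measureReal_notMem_heavyArms_le_expectedRegret {ν : BanditInstance K} {i : Fin K}
    {ε : ℝ} {m : ℕ} (hε : 0 ≤ ε) (h : ∀ j, j ≠ i → ν.mean j + ε ≤ ν.bestMean) :
    ε * (T + 1 - m) * (alg.lawUnder ν).real {ω | i ∉ alg.heavyArms m ω.1 ω.2} ≤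
      alg.expectedRegret ν := by
  have hE := alg.measurableSet_notMem_heavyArms m i
  set E := {ω : Seed × (Fin K × ℕ → unitInterval) | i ∉ alg.heavyArms m ω.1 ω.2} with hEdef
  have h1 : ∫ ω, E.indicator (fun _ => ε * (T + 1 - m)) ω ∂(alg.lawUnder ν) =
      ε * (T + 1 - m) * (alg.lawUnder ν).real E := by
    rw [integral_indicator_const _ hE, smul_eq_mul, mul_comm]
  rw [← h1]
  refine integral_mono ((integrable_const _).indicator hE) (alg.integrable_pseudoRegret ν) ?_
  intro ω
  have hreg : ε * (T - (alg.stateAfter ω.1 ω.2 T).pulls i) ≤ alg.pseudoRegret ν ω := by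
    have hcard := Finset.card_filter_add_card_filter_not (s := Finset.range T)
      (fun t => alg.action ω.1 ω.2 t = i)
    rw [Finset.card_range, ← pulls_eq_card] at hcard
    have : (T : ℝ) - (alg.stateAfter ω.1 ω.2 T).pulls i =
        ∑ t ∈ Finset.range T, if ¬ alg.action ω.1 ω.2 t = i then (1 : ℝ) else 0 := by
      rw [Finset.sum_boole, sub_eq_iff_eq_add']
      exact_mod_cast hcard.symm
    rw [this, Finset.mul_sum]
    refine Finset.sum_le_sum fun t _ => ?_
    split_ifs with ht
    · linarith [ν.mean_le_bestMean (alg.action ω.1 ω.2 t)]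
    · linarith [h _ ht]
  by_cases hω : ω ∈ E
  · rw [Set.indicator_of_mem hω]
    refine le_trans ?_ hreg
    have hlt : (alg.stateAfter ω.1 ω.2 T).pulls i + 1 ≤ m := by
      simpa [hEdef, mem_heavyArms] using hω
    have hlt' : ((alg.stateAfter ω.1 ω.2 T).pulls i : ℝ) + 1 ≤ m := by exact_mod_cast hlt
    exact mul_le_mul_of_nonneg_left (by linarith) hε
  · rw [Set.indicator_of_notMem hω]
    exact Finset.sum_nonneg fun t _ => sub_nonneg.2 (ν.mean_le_bestMean _)

/-- Each heavy arm of `A` accounts for at least `m` rounds of cost at least `Δ`, and distinct arms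
use distinct rounds. -/
theorem sum_measureReal_mem_heavyArms_le_expectedRegret {ν : BanditInstance K}
    {A : Finset (Fin K)} {Δ : ℝ} {m : ℕ} (hΔ : 0 ≤ Δ) (h : ∀ j ∈ A, ν.mean j + Δ ≤ ν.bestMean) :
    Δ * m * ∑ i ∈ A, (alg.lawUnder ν).real {ω | i ∈ alg.heavyArms m ω.1 ω.2} ≤
      alg.expectedRegret ν := by
  have hE := alg.measurableSet_mem_heavyArms m
  set E := fun i => {ω : Seed × (Fin K × ℕ → unitInterval) | i ∈ alg.heavyArms m ω.1 ω.2}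
    with hEdef
  have hint : ∀ i ∈ A, Integrable ((E i).indicator fun _ => Δ * m) (alg.lawUnder ν) :=
    fun i _ => (integrable_const _).indicator (hE i)
  have h1 : ∫ ω, ∑ i ∈ A, (E i).indicator (fun _ => Δ * m) ω ∂(alg.lawUnder ν) =
      Δ * m * ∑ i ∈ A, (alg.lawUnder ν).real (E i) := by
    rw [integral_finsetSum _ hint, Finset.mul_sum]
    refine Finset.sum_congr rfl fun i _ => ?_
    rw [integral_indicator_const _ (hE i), smul_eq_mul, mul_comm]
  rw [← h1]
  refine integral_mono (integrable_finsetSum _ hint) (alg.integrable_pseudoRegret ν) ?_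
  intro ω
  calc ∑ i ∈ A, (E i).indicator (fun _ => Δ * m) ω
      ≤ ∑ i ∈ A, Δ * (alg.stateAfter ω.1 ω.2 T).pulls i := by
        refine Finset.sum_le_sum fun i _ => ?_
        by_cases hω : ω ∈ E i
        · rw [Set.indicator_of_mem hω]
          have : m ≤ (alg.stateAfter ω.1 ω.2 T).pulls i := by
            simpa [hEdef, mem_heavyArms] using hω
          gcongr
        · rw [Set.indicator_of_notMem hω]
          positivity
    _ = ∑ t ∈ Finset.range T, ∑ i ∈ A, if alg.action ω.1 ω.2 t = i then Δ else 0 := by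
        rw [Finset.sum_comm]
        refine Finset.sum_congr rfl fun i _ => ?_
        rw [pulls_eq_card, ← Finset.sum_filter, Finset.sum_const, nsmul_eq_mul, mul_comm]
    _ ≤ ∑ t ∈ Finset.range T, (ν.bestMean - ν.mean (alg.action ω.1 ω.2 t)) := by
        refine Finset.sum_le_sum fun t _ => ?_
        rw [Finset.sum_ite_eq]
        split_ifs with ht
        · linarith [h _ ht]
        · linarith [ν.mean_le_bestMean (alg.action ω.1 ω.2 t)]

/-- If the regret is small, the arms pulled at least `m` times are close to the arms of mean
`1 / 2`. -/
theorem integral_card_symmDiff_heavyArms_le {R ε : ℝ} {m : ℕ} (hT : 0 < T)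
    (hreg : ∀ ν ∈ BanditInstance.bernoulliClass K, alg.expectedRegret ν ≤ R)
    (hε : 0 < ε) (hε' : ε ≤ 1 / 4) (hm0 : 0 < m) (hm : 8 * m * ε ^ 2 ≤ 1) (hmT : 2 * m ≤ T + 2)
    (hRε : 16384 * R ≤ ε * T) (hRm : 256 * R ≤ m * K) {S : Finset (Fin K)} (hS : S.Nonempty) :
    Integrable (fun ω => ((symmDiff S (alg.heavyArms m ω.1 ω.2)).card : ℝ))
        (alg.lawUnder (.bernoulli (BanditInstance.twoLevelMean S))) ∧
      ∫ ω, ((symmDiff S (alg.heavyArms m ω.1 ω.2)).card : ℝ)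
        ∂(alg.lawUnder (.bernoulli (BanditInstance.twoLevelMean S))) ≤ K / 32 := by
  classical
  set P := alg.lawUnder (.bernoulli (BanditInstance.twoLevelMean S)) with hP
  have hnot : ∀ i ∈ S, Integrable ({ω : Seed × (Fin K × ℕ → unitInterval) |
      i ∉ alg.heavyArms m ω.1 ω.2}.indicator fun _ => (1 : ℝ)) P := fun i _ =>
    (integrable_const _).indicator (alg.measurableSet_notMem_heavyArms m i)
  have hmem : ∀ i ∈ Sᶜ, Integrable ({ω : Seed × (Fin K × ℕ → unitInterval) |
      i ∈ alg.heavyArms m ω.1 ω.2}.indicator fun _ => (1 : ℝ)) P := fun i _ =>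
    (integrable_const _).indicator (alg.measurableSet_mem_heavyArms m i)
  simp_rw [card_symmDiff_heavyArms]
  refine ⟨(integrable_finsetSum _ hnot).add (integrable_finsetSum _ hmem), ?_⟩
  rw [integral_add (integrable_finsetSum _ hnot) (integrable_finsetSum _ hmem),
    integral_finsetSum _ hnot, integral_finsetSum _ hmem]
  simp_rw [integral_indicator_const (1 : ℝ) (alg.measurableSet_notMem_heavyArms m _),
    integral_indicator_const (1 : ℝ) (alg.measurableSet_mem_heavyArms m _), smul_eq_mul, mul_one]
  -- An arm of mean `1/2` must exist for the arms outside `S` to have gap `1/4`.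
  obtain ⟨s, hs⟩ := hS
  have hgood : ∀ i ∈ S, P.real {ω | i ∉ alg.heavyArms m ω.1 ω.2} ≤ 1 / 64 := by
    intro i hi
    let q : unitInterval := ⟨1 / 2 + ε, by linarith, by linarith⟩
    have hq : (q : ℝ) = 1 / 2 + ε := rfl
    have h1 := alg.lawUnder_notMem_heavyArms_le (BanditInstance.twoLevelMean S) hε hm hε'
      (BanditInstance.twoLevelMean_of_mem hi) hq
    set ν := BanditInstance.bernoulli (Function.update (BanditInstance.twoLevelMean S) i q)
    have h2 := (alg.mul_measureReal_notMem_heavyArms_le_expectedRegret (ν := ν) (i := i) (m := m)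
      hε.le (fun j hj => by
        refine le_trans ?_ (ν.mean_le_bestMean i)
        simp only [ν, BanditInstance.mean_bernoulli, Function.update_self,
          Function.update_of_ne hj, hq]
        linarith [BanditInstance.twoLevelMean_le S j])).trans
      (hreg ν (BanditInstance.bernoulli_mem_bernoulliClass _))
    set x := (alg.lawUnder ν).real {ω | i ∉ alg.heavyArms m ω.1 ω.2}
    have hx : 0 ≤ x := measureReal_nonneg
    have hT' : (0 : ℝ) < T := by exact_mod_cast hT
    have hmT' : (2 : ℝ) * m ≤ T + 2 := by exact_mod_cast hmT
    have h3 : ε * (T / 2) * x ≤ ε * (T + 1 - m) * x := by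
      gcongr
      linarith
    -- The regret in the raised instance gives `x ≤ 1 / 8192`, whence `64 * x + 1 / 128 ≤ 1 / 64`.
    have h4 : (ε * T) * (8192 * x) ≤ (ε * T) * 1 := by nlinarith
    have h5 := le_of_mul_le_mul_left h4 (by positivity)
    linarith
  have hbad := (alg.sum_measureReal_mem_heavyArms_le_expectedRegret (A := Sᶜ) (m := m)
    (ν := .bernoulli (BanditInstance.twoLevelMean S)) (Δ := 1 / 4) (by norm_num)
    (fun j hj => by
      refine le_trans ?_ (BanditInstance.mean_le_bestMean _ s)
      rw [BanditInstance.mean_bernoulli, BanditInstance.mean_bernoulli,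
        BanditInstance.twoLevelMean_of_mem hs,
        BanditInstance.twoLevelMean_of_notMem (Finset.mem_compl.1 hj)]
      norm_num)).trans (hreg _ (BanditInstance.bernoulli_mem_bernoulliClass _))
  rw [← hP] at hbad
  have hm0' : (0 : ℝ) < m := by exact_mod_cast hm0
  have hsum : ∑ i ∈ S, P.real {ω | i ∉ alg.heavyArms m ω.1 ω.2} ≤ K / 64 := by
    have hcard : (S.card : ℝ) ≤ K := by exact_mod_cast (card_finset_fin_le S)
    refine (Finset.sum_le_card_nsmul S _ _ hgood).trans ?_
    rw [nsmul_eq_mul]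
    linarith
  have hbad' : (m : ℝ) * (64 * ∑ i ∈ Sᶜ, P.real {ω | i ∈ alg.heavyArms m ω.1 ω.2}) ≤ m * K := by
    linarith
  have := le_of_mul_le_mul_left hbad' hm0'
  linarith

end Measurability

end BatchedBandit

/-! ### Counting sets close to a code. -/

/-- The involution `S ↦ symmDiff S A` reduces the sum to `A = ∅`, the binomial theorem. -/
theorem Finset.sum_pow_card_symmDiff {α : Type*} [Fintype α] [DecidableEq α] (A : Finset α)
    (x : ℝ) : ∑ S : Finset α, x ^ (symmDiff S A).card = (x + 1) ^ Fintype.card α := by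
  rw [← Fintype.sum_pow_mul_eq_add_pow α x 1]
  simp only [one_pow, mul_one]
  exact Fintype.sum_equiv (Function.Involutive.toPerm (fun S => symmDiff S A)
    fun S => symmDiff_symmDiff_cancel_right A S) _ _ fun S => rfl

/-- A family of sets that a code `𝒜` approximates up to `d` elements on average is not much larger
than `𝒜` times the exponential volume of a Hamming ball. -/
theorem Finset.card_mul_exp_le_of_sum_card_symmDiff_le {α : Type*} [Fintype α] [DecidableEq α]
    (𝒮 𝒜 : Finset (Finset α)) (f : Finset α → Finset α) (hf : ∀ S ∈ 𝒮, f S ∈ 𝒜) {d : ℝ}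
    (hd : ∑ S ∈ 𝒮, ((symmDiff S (f S)).card : ℝ) ≤ 𝒮.card * d) :
    𝒮.card * Real.exp (-(d * Real.log 4)) ≤ 𝒜.card * (5 / 4) ^ Fintype.card α := by
  have hlog : 0 ≤ Real.log 4 := Real.log_nonneg (by norm_num)
  have hpow : ∀ n : ℕ, ((1 / 4 : ℝ)) ^ n = Real.exp (-(n * Real.log 4)) := by
    intro n
    rw [Real.exp_neg, Real.exp_nat_mul, Real.exp_log (by norm_num), one_div, inv_pow]
  -- The tangent of the convex function `4 ^ (-x)` at `d`; summed over `𝒮` its linear term is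
  -- nonnegative, which is Jensen's inequality.
  have hlow : ∀ n : ℕ, Real.exp (-(d * Real.log 4)) * (1 + (d - n) * Real.log 4) ≤
      (1 / 4 : ℝ) ^ n := by
    intro n
    have h := Real.add_one_le_exp ((d - n) * Real.log 4)
    calc _ ≤ Real.exp (-(d * Real.log 4)) * Real.exp ((d - n) * Real.log 4) := by
          gcongr
          linarith
      _ = (1 / 4 : ℝ) ^ n := by
          rw [hpow, ← Real.exp_add]
          ring_nf
  calc 𝒮.card * Real.exp (-(d * Real.log 4))
      ≤ ∑ S ∈ 𝒮, Real.exp (-(d * Real.log 4)) *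
          (1 + (d - (symmDiff S (f S)).card) * Real.log 4) := by
        rw [← Finset.mul_sum, Finset.sum_add_distrib, ← Finset.sum_mul, Finset.sum_sub_distrib,
          mul_comm]
        simp only [Finset.sum_const, nsmul_eq_mul, mul_one]
        have : 0 ≤ (𝒮.card * d - ∑ S ∈ 𝒮, ((symmDiff S (f S)).card : ℝ)) * Real.log 4 :=
          mul_nonneg (sub_nonneg.2 hd) hlog
        gcongr
        linarith
    _ ≤ ∑ S ∈ 𝒮, (1 / 4 : ℝ) ^ (symmDiff S (f S)).card := Finset.sum_le_sum fun S _ => hlow _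
    _ ≤ ∑ S ∈ 𝒮, ∑ A ∈ 𝒜, (1 / 4 : ℝ) ^ (symmDiff S A).card := by
        refine Finset.sum_le_sum fun S hS => ?_
        exact Finset.single_le_sum (f := fun A => (1 / 4 : ℝ) ^ (symmDiff S A).card)
          (fun A _ => by positivity) (hf S hS)
    _ ≤ ∑ S : Finset α, ∑ A ∈ 𝒜, (1 / 4 : ℝ) ^ (symmDiff S A).card :=
        Finset.sum_le_sum_of_subset_of_nonneg (Finset.subset_univ _) fun S _ _ =>
          Finset.sum_nonneg fun A _ => by positivity
    _ = 𝒜.card * (5 / 4) ^ Fintype.card α := by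
        rw [Finset.sum_comm]
        simp only [Finset.sum_pow_card_symmDiff]
        rw [Finset.sum_const, nsmul_eq_mul]
        norm_num

/-! ### Fixing the seed and comparing cardinalities. -/

namespace BatchedBandit

variable {K T B : ℕ} {M Seed : Type*} [MeasurableSpace M] [MeasurableSpace Seed]
  (alg : BatchedBandit K T B M Seed)

/-- If the average distance of `heavyArms` to the arms of mean `1 / 2` is at most `d` for all sets
in `𝒮`, this holds for some fixed seed and fixed reward tables. -/
theorem exists_seed_forall_exists_table (𝒮 : Finset (Finset (Fin K))) (m : ℕ) {d : ℝ}
    (h : ∀ S ∈ 𝒮, Integrable (fun ω => ((symmDiff S (alg.heavyArms m ω.1 ω.2)).card : ℝ))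
        (alg.lawUnder (.bernoulli (BanditInstance.twoLevelMean S))) ∧
      ∫ ω, ((symmDiff S (alg.heavyArms m ω.1 ω.2)).card : ℝ)
        ∂(alg.lawUnder (.bernoulli (BanditInstance.twoLevelMean S))) ≤ d) :
    ∃ (u : Seed) (X : Finset (Fin K) → Fin K × ℕ → unitInterval),
      ∑ S ∈ 𝒮, ((symmDiff S (alg.heavyArms m u (X S))).card : ℝ) ≤ 𝒮.card * d := by
  classical
  let ρ : Finset (Fin K) → Measure (Fin K × ℕ → unitInterval) := fun S =>
    Measure.infinitePi fun p : Fin K × ℕ =>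
      (BanditInstance.bernoulli (BanditInstance.twoLevelMean S) p.1 : Measure unitInterval)
  let g : Finset (Fin K) → Seed → ℝ := fun S u =>
    ∫ X, ((symmDiff S (alg.heavyArms m u X)).card : ℝ) ∂(ρ S)
  have hg : ∀ S ∈ 𝒮, Integrable (g S) alg.seedLaw := fun S hS => (h S hS).1.integral_prod_left
  have hgd : ∀ S ∈ 𝒮, ∫ u, g S u ∂alg.seedLaw ≤ d := fun S hS => by
    rw [← integral_prod _ (h S hS).1]
    exact (h S hS).2
  have hae : ∀ᵐ u ∂alg.seedLaw, ∀ S ∈ 𝒮,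
      Integrable (fun X => ((symmDiff S (alg.heavyArms m u X)).card : ℝ)) (ρ S) :=
    (Finset.eventually_all 𝒮).2 fun S hS => (h S hS).1.prod_right_ae
  -- All instances share the seed law, so a single seed is at most average for the sum over `𝒮`; it
  -- also avoids the null set where integrability in the table fails. Tables are then chosen for
  -- each `S` separately.
  obtain ⟨u, hu, hle⟩ := exists_notMem_null_le_integral (integrable_finsetSum 𝒮 hg)
    (ae_iff.1 hae)
  have hu' : ∀ S ∈ 𝒮,
      Integrable (fun X => ((symmDiff S (alg.heavyArms m u X)).card : ℝ)) (ρ S) := by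
    simpa using hu
  have hX : ∀ S, ∃ X, S ∈ 𝒮 → ((symmDiff S (alg.heavyArms m u X)).card : ℝ) ≤ g S u := by
    intro S
    by_cases hS : S ∈ 𝒮
    · obtain ⟨X, hX⟩ := exists_le_integral (hu' S hS)
      exact ⟨X, fun _ => hX⟩
    · exact ⟨fun _ => 0, fun h => absurd h hS⟩
  choose X hX using hX
  refine ⟨u, X, ?_⟩
  calc _ ≤ ∑ S ∈ 𝒮, g S u := Finset.sum_le_sum fun S hS => hX S hS
    _ ≤ ∫ u, ∑ S ∈ 𝒮, g S u ∂alg.seedLaw := hle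
    _ = ∑ S ∈ 𝒮, ∫ u, g S u ∂alg.seedLaw := integral_finsetSum _ hg
    _ ≤ ∑ S ∈ 𝒮, d := Finset.sum_le_sum hgd
    _ = _ := by rw [Finset.sum_const, nsmul_eq_mul]

/-- The memory bound in terms of a threshold `m` on the number of pulls and a gap `ε`. -/
theorem half_mul_sub_one_le_of_regret_le [Fintype M] [DiscreteMeasurableSpace M] {R ε W : ℝ}
    {m : ℕ} (hK : 0 < K) (hT : 0 < T) (hB : 0 < B) (hW : (Fintype.card M : ℝ) ≤ (2 : ℝ) ^ W)
    (hreg : ∀ ν ∈ BanditInstance.bernoulliClass K, alg.expectedRegret ν ≤ R)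
    (hε : 0 < ε) (hε' : ε ≤ 1 / 4) (hm0 : 0 < m) (hm : 8 * m * ε ^ 2 ≤ 1) (hmT : 2 * m ≤ T + 2)
    (hRε : 16384 * R ≤ ε * T) (hRm : 256 * R ≤ m * K) :
    (K : ℝ) / 2 - 1 ≤ W * B := by
  classical
  -- `∅` is excluded because without an arm of mean `1/2` there is no gap.
  set 𝒮 : Finset (Finset (Fin K)) := Finset.univ.erase ∅ with h𝒮
  obtain ⟨u, X, hX⟩ := alg.exists_seed_forall_exists_table 𝒮 m (d := K / 32) fun S hS =>
    alg.integral_card_symmDiff_heavyArms_le hT hreg hε hε' hm0 hm hmT hRε hRm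
      (Finset.nonempty_iff_ne_empty.2 (Finset.ne_of_mem_erase hS))
  obtain ⟨𝒩, h𝒩, hmem⟩ := alg.exists_finset_pulls_mem u hB
  have key := Finset.card_mul_exp_le_of_sum_card_symmDiff_le 𝒮
    (𝒩.image fun N => Finset.univ.filter fun i => m ≤ N i) (fun S => alg.heavyArms m u (X S))
    (fun S _ => Finset.mem_image_of_mem _ (hmem (X S))) hX
  have hcard𝒮 : (2 : ℝ) ^ K / 2 ≤ 𝒮.card := by
    have h1 : 𝒮.card + 1 = 2 ^ K := by
      rw [h𝒮, Finset.card_erase_add_one (Finset.mem_univ _), Finset.card_univ, Fintype.card_finset,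
        Fintype.card_fin]
    have h2 : (𝒮.card : ℝ) + 1 = 2 ^ K := by exact_mod_cast h1
    have h3 : (2 : ℝ) ^ 1 ≤ 2 ^ K := pow_le_pow_right₀ (by norm_num) hK
    linarith
  have hcard𝒜 : (((𝒩.image fun N => Finset.univ.filter fun i => m ≤ N i).card : ℕ) : ℝ) ≤
      ((2 : ℝ) ^ W) ^ B := by
    calc _ ≤ ((Fintype.card M ^ B : ℕ) : ℝ) := by
          exact_mod_cast Finset.card_image_le.trans h𝒩
      _ ≤ _ := by
          push_cast
          gcongr
  rw [Fintype.card_fin] at key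
  have hfin : (2 : ℝ) ^ K / 2 * Real.exp (-(K / 32 * Real.log 4)) ≤
      ((2 : ℝ) ^ W) ^ B * (5 / 4) ^ K :=
    (mul_le_mul_of_nonneg_right hcard𝒮 (Real.exp_pos _).le).trans
      (key.trans (mul_le_mul_of_nonneg_right hcard𝒜 (by positivity)))
  have hlog := Real.log_le_log (by positivity) hfin
  rw [Real.log_mul (by positivity) (Real.exp_ne_zero _), Real.log_exp,
    Real.log_div (by positivity) (by norm_num), Real.log_mul (by positivity) (by positivity),
    Real.log_pow, Real.log_pow, Real.log_pow, Real.log_rpow (by norm_num)] at hlog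
  have h4 : Real.log 4 = 2 * Real.log 2 := by
    rw [show (4 : ℝ) = 2 ^ 2 by norm_num, Real.log_pow]
    norm_num
  have h5 : 3 * Real.log (5 / 4) ≤ Real.log 2 := by
    have := Real.log_le_log (by norm_num) (by norm_num : ((5 : ℝ) / 4) ^ 3 ≤ 2)
    rw [Real.log_pow] at this
    exact_mod_cast this
  have hl2 : 0 < Real.log 2 := Real.log_pos (by norm_num)
  have hK' : (0 : ℝ) < K := by exact_mod_cast hK
  have h6 : (K : ℝ) * (3 * Real.log (5 / 4)) ≤ K * Real.log 2 :=
    mul_le_mul_of_nonneg_left h5 hK'.le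
  rw [h4] at hlog
  have h7 : 0 < (K : ℝ) * Real.log 2 := by positivity
  refine le_of_mul_le_mul_right (a := Real.log 2) ?_ hl2
  -- In units of `log 2`: `K - 1 - K / 16 ≤ W * B + K / 3`, and `1 - 1/16 - 1/3 ≥ 1/2`.
  linarith

/-! ### Choice of `ε` and `m`. -/

/-- The memory bound under the regret and horizon conditions, for at least `16` arms. -/
theorem half_mul_sub_one_le_of_regret_le_sqrt [Fintype M] [DiscreteMeasurableSpace M] {C W : ℝ}
    (hK : 16 ≤ K) (hT : 0 < T) (hB : 0 < B) (hW : (Fintype.card M : ℝ) ≤ (2 : ℝ) ^ W) (hC : 1 ≤ C)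
    (hreg : ∀ ν ∈ BanditInstance.bernoulliClass K,
      alg.expectedRegret ν ≤ C * √((K : ℝ) * T) * Real.log T * Real.log K)
    (hTC : (2 : ℝ) ^ 80 * C ^ 6 * K * Real.log T ^ 6 * Real.log K ^ 6 ≤ (T : ℝ)) :
    (K : ℝ) / 2 - 1 ≤ W * B := by
  have hK0 : (0 : ℝ) < K := by exact_mod_cast (by omega : 0 < K)
  have hK16 : (16 : ℝ) ≤ K := by exact_mod_cast hK
  rcases (by omega : T = 1 ∨ 2 ≤ T) with rfl | hT2
  -- Here `log T = 0`, so the regret bound is `0`; otherwise `log T * log K ≥ 1`, which gives `D ≥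
  -- 1` below.
  · refine alg.half_mul_sub_one_le_of_regret_le (R := 0) (ε := 1 / 4) (m := 1) (by omega) hT hB hW
      (fun ν hν => ?_) (by norm_num) le_rfl one_pos (by norm_num) (by norm_num) (by norm_num)
      (by simp)
    simpa using hreg ν hν
  have hT0 : (0 : ℝ) < T := by exact_mod_cast hT
  have hT2' : (2 : ℝ) ≤ T := by exact_mod_cast hT2
  have hlog2 : (1 / 2 : ℝ) ≤ Real.log 2 := by linarith [Real.log_two_gt_d9]
  have hlogT : 1 / 2 ≤ Real.log T := hlog2.trans (Real.log_le_log (by norm_num) hT2')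
  have hlogK : 2 ≤ Real.log K := by
    have := Real.log_le_log (by norm_num) hK16
    rw [show (16 : ℝ) = 2 ^ 4 by norm_num, Real.log_pow] at this
    push_cast at this
    linarith
  obtain ⟨D, hD⟩ : ∃ D, D = C * (Real.log T * Real.log K) := ⟨_, rfl⟩
  have hD1 : 1 ≤ D := by
    have : 1 ≤ Real.log T * Real.log K := by nlinarith
    rw [hD]
    nlinarith
  obtain ⟨y, hy⟩ : ∃ y : ℝ, y = √(T / K) := ⟨_, rfl⟩
  have hy0 : 0 < y := by rw [hy]; positivity
  have hyT : (T : ℝ) = y ^ 2 * K := by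
    rw [hy, Real.sq_sqrt (by positivity)]
    field_simp
  have hsqrt : √((K : ℝ) * T) = K * y := by
    rw [hyT, show (K : ℝ) * (y ^ 2 * K) = (K * y) ^ 2 by ring, Real.sqrt_sq (by positivity)]
  have hyD : (2 : ℝ) ^ 40 * D ^ 3 ≤ y := by
    refine (sq_le_sq₀ (by positivity) hy0.le).1 ?_
    refine le_of_mul_le_mul_right (a := (K : ℝ)) ?_ hK0
    rw [← hyT, hD]
    refine le_trans (le_of_eq ?_) hTC
    ring
  have hDy : (2 : ℝ) ^ 40 * D ≤ y := by
    refine le_trans ?_ hyD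
    gcongr
    exact le_self_pow₀ hD1 (by norm_num)
  -- With `R = D * (K * y)` and `T = y ^ 2 * K`, this is the smallest gap with `16384 * R ≤ ε * T`.
  obtain ⟨ε, hε⟩ : ∃ ε : ℝ, ε = 16384 * D / y := ⟨_, rfl⟩
  have hε0 : 0 < ε := by rw [hε]; positivity
  have hεy : ε * y = 16384 * D := by rw [hε]; field_simp
  have hε4 : ε ≤ 1 / 2 ^ 26 := by
    rw [hε, div_le_div_iff₀ hy0 (by norm_num)]
    norm_num at hDy ⊢
    linarith
  -- The largest threshold that the change of measure tolerates; rounding it down loses at most a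
  -- factor `2`.
  obtain ⟨z, hz⟩ : ∃ z : ℝ, z = 1 / (8 * ε ^ 2) := ⟨_, rfl⟩
  have hzε : 8 * ε ^ 2 * z = 1 := by rw [hz]; field_simp
  have hz1 : 1 ≤ z := by
    rw [hz, le_div_iff₀ (by positivity)]
    nlinarith
  have hfl : (⌊z⌋₊ : ℝ) ≤ z := Nat.floor_le (by positivity)
  have hfl0 : 0 < ⌊z⌋₊ := Nat.floor_pos.2 hz1
  have hfl2 : z ≤ 2 * ⌊z⌋₊ := by
    have h1 : (1 : ℝ) ≤ ⌊z⌋₊ := by exact_mod_cast hfl0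
    have h2 := Nat.lt_floor_add_one z
    linarith
  have hzy : 8 * (16384 * D) ^ 2 * z = y ^ 2 := by
    rw [← hεy]
    linear_combination y ^ 2 * hzε
  refine alg.half_mul_sub_one_le_of_regret_le (R := D * (K * y)) (ε := ε) (m := ⌊z⌋₊) (by omega) hT
    hB hW (fun ν hν => ?_) hε0 (hε4.trans (by norm_num)) hfl0 ?_ ?_ ?_ ?_
  · refine (hreg ν hν).trans_eq ?_
    rw [hsqrt, hD]
    ring
  · calc 8 * (⌊z⌋₊ : ℝ) * ε ^ 2 ≤ 8 * z * ε ^ 2 := by gcongr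
      _ = 1 := by linarith
  · have h1 : 2 * z ≤ T := by
      have h2 : (1 : ℝ) ≤ D ^ 2 := one_le_pow₀ hD1
      have h3 : z ≤ D ^ 2 * z := le_mul_of_one_le_left (by positivity) h2
      have h4 : y ^ 2 ≤ T := by rw [hyT]; exact le_mul_of_one_le_right (by positivity) (by linarith)
      nlinarith
    have : (2 * ⌊z⌋₊ : ℝ) ≤ ((T + 2 : ℕ) : ℝ) := by
      push_cast
      linarith
    exact_mod_cast this
  · rw [hyT]
    exact le_of_eq (by linear_combination (-(y * K)) * hεy)
  -- Since `z = y ^ 2 / (2 ^ 31 * D ^ 2)`, the need `512 * D * y ≤ z` reads `2 ^ 40 * D ^ 3 ≤ y`;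
  -- squared, this is the horizon condition with constant `2 ^ 80`.
  · have h1 : 256 * (D * y) ≤ ⌊z⌋₊ := by
      have h2 : (2 : ℝ) ^ 31 * D ^ 2 * (512 * (D * y)) ≤ 2 ^ 31 * D ^ 2 * z := by
        calc (2 : ℝ) ^ 31 * D ^ 2 * (512 * (D * y)) = (2 ^ 40 * D ^ 3) * y := by ring
          _ ≤ y * y := by gcongr
          _ = 2 ^ 31 * D ^ 2 * z := by rw [← sq, ← hzy]; ring
      have h3 := le_of_mul_le_mul_left h2 (by positivity)
      linarith
    calc 256 * (D * (K * y)) = 256 * (D * y) * K := by ring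
      _ ≤ ⌊z⌋₊ * K := by gcongr

end BatchedBandit

theorem mainTheorem1 :
    ∃ c γ₀ γ : ℝ, ∃ K₀ : ℕ, 0 < c ∧ 0 < γ₀ ∧ 0 < γ ∧
      ∀ (K T B : ℕ) (W C : ℝ), 0 < K → Even K → 0 < T → 0 < B → 0 < W → 1 ≤ C →
      ∀ (M Seed : Type*) [Fintype M] [MeasurableSpace M] [DiscreteMeasurableSpace M]
        [MeasurableSpace Seed] (alg : BatchedBandit K T B M Seed),
        alg.IsGridValid →
        (Fintype.card M : ℝ) ≤ (2 : ℝ) ^ W →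
        (∀ ν ∈ BanditInstance.bernoulliClass K,
          alg.expectedRegret ν ≤ C * √((K : ℝ) * T) * Real.log T * Real.log K) →
        c * C ^ 6 * K * Real.log T ^ 6 * Real.log K ^ 6 ≤ (T : ℝ) →
        (γ₀ * K - 1 / 2 * Real.logb 2 (2 * K)) / W ≤ (B : ℝ) ∧
          (K₀ ≤ K → γ * K / W ≤ (B : ℝ)) := by
  refine ⟨2 ^ 80, 1 / 16, 1 / 16, 16, by positivity, by positivity, by positivity, ?_⟩
  intro K T B W C hK heven hT hB hW hC M Seed _ _ _ _ alg _ hcard hreg hTC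
  have hK2 : 2 ≤ K := by
    obtain ⟨k, rfl⟩ := heven
    omega
  have hK2' : (2 : ℝ) ≤ K := by exact_mod_cast hK2
  have hlogb : 2 ≤ Real.logb 2 (2 * K) := by
    rw [Real.le_logb_iff_rpow_le (by norm_num) (by positivity)]
    norm_num
    linarith
  have hlarge : 16 ≤ K → 1 / 16 * (K : ℝ) ≤ W * B := by
    intro h16
    have h := alg.half_mul_sub_one_le_of_regret_le_sqrt h16 hT hB hcard hC hreg hTC
    have : (16 : ℝ) ≤ K := by exact_mod_cast h16
    linarith
  refine ⟨?_, fun h16 => ?_⟩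
  · rw [div_le_iff₀ hW, mul_comm (B : ℝ)]
    -- For `K < 16` the numerator is negative: `K / 16 < 1 ≤ logb 2 (2 * K) / 2`.
    rcases lt_or_ge K 16 with h | h
    · have h' : (K : ℝ) < 16 := by exact_mod_cast h
      have : 0 ≤ W * B := by positivity
      linarith
    · linarith [hlarge h]
  · rw [div_le_iff₀ hW, mul_comm (B : ℝ)]
    exact hlarge h16
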